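/- Identify Lorentz--Minkowski space $\mathbb L^3$ (metric $dx^2+dy^2-dt^2$) with $\mathbb C\times\mathbb R$ by $(x,y,t)\mapsto(x+iy,t)$, and write $A(r,R)=\{z\in\mathbb C: r<|z|<R\}$. A *generalised maximal surface* on a domain $\Omega\subset\mathbb C$ is a smooth map $F=(h,w):\Omega\to\mathbb C\times\mathbb R$ with $h_{z\bar z}=0$, $w_{z\bar z}=0$, $h_z\overline{h_{\bar z}}-w_z^2=0$ on $\Omega$, and $|h_z|$ not identically equal to $|h_{\bar z}|$ on $\Omega$. Its *singular set* is $\{z\in\Omega: |h_z|=|h_{\bar z}|\}$. Let $\gamma=(\gamma_1+i\gamma_2,\gamma_3):S^1\to\mathbb L^3$ be a real-analytic closed curve that is null ($\langle\gamma',\gamma'\rangle=0$, where $'=d/d\theta$ and zeros of $\gamma'$ are allowed), and let $L=(L_1+iL_2,L_3):S^1\to\mathbb L^3$ be a real-analytic vector field that is null ($\langle L,L\rangle=0$, zeros allowed), with $\langle\gamma',L\rangle=0$ on $S^1$ and at least one of $\gamma'$, $L$ not identically zero. Consider the map $$g=\sqrt{\frac{L_1+iL_2}{L_1-iL_2}}\quad\text{where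 } L_1+iL_2\neq0,\qquad g=\sqrt{\frac{\gamma_1'+i\gamma_2'}{\gamma_1'-i\gamma_2'}}\quad\text{where }\gamma_1'+i\gamma_2'\ne0$$ on $S^1$. It is well defined: there are an annulus $A(r_0,R_0)$ with $0<r_0<1<R_0$ and a holomorphic function $g(z)$ on it whose square on $S^1$ is given by both formulas wherever they make sense. Let $g(z)$ be any such analytic extension, on any annulus $A(r_0,R_0)$ with $0<r_0<1<R_0$. If $|g(z)|$ is not identically $1$ on $A(r_0,R_0)$, then there are $0<r<1<R$ and a generalised maximal surface $F=(h,w):A(r,R)\to\mathbb L^3$ such that, for all $\theta$, 1. $F(e^{i\theta})=\gamma(e^{i\theta})$, 2. $\left.\dfrac{\partial F}{\partial\rho}\right|_{e^{i\theta}}=L(e^{i\theta})$ (with $z=\rho e^{i\theta}$), and the singular set of $F$ contains $\{|z|=1\}$. The surface $F$ is unique: every generalised maximal surface on an annulus $A(r',R')$ with $0<r'<1<R'$ that satisfies 1 and 2 agrees with $F$ on $A(r,R)\cap A(r',R')$. -/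

import Mathlib

open scoped ComplexConjugate ContDiff

noncomputable section

/-- Lorentz-Minkowski space `𝕃³`, identified with `ℂ × ℝ` through `(x, y, t) ↦ (x + i y, t)`. -/
abbrev LorentzSpace : Type := ℂ × ℝ

/-- The Lorentz inner product `⟨p, q⟩ = p₁ q₁ + p₂ q₂ - p₃ q₃` of signature `(+, +, -)`. -/
def lorentzInner (p q : LorentzSpace) : ℝ :=
  p.1.re * q.1.re + p.1.im * q.1.im - p.2 * q.2

/-- A vector is null if `⟨p, p⟩ = 0`; the zero vector is allowed. -/
def IsNull (p : LorentzSpace) : Prop := lorentzInner p p = 0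

/-- Real analyticity of a map on the unit circle, read in the angular coordinate. -/
def IsAnalyticOnCircle (f : Circle → LorentzSpace) : Prop :=
  ∀ θ : ℝ, AnalyticAt ℝ (fun t : ℝ => f (Circle.exp t)) θ

/-- The derivative `f'(θ)` of `θ ↦ f (e^{iθ})`. -/
def angularDeriv (f : Circle → LorentzSpace) (θ : ℝ) : LorentzSpace :=
  deriv (fun t : ℝ => f (Circle.exp t)) θ

/-- Singular Björling data for a closed curve. -/
structure IsSingularBjorlingData (γ L : Circle → LorentzSpace) : Prop where
  analytic_curve : IsAnalyticOnCircle γ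
  analytic_field : IsAnalyticOnCircle L
  null_curve : ∀ θ : ℝ, IsNull (angularDeriv γ θ)
  null_field : ∀ p : Circle, IsNull (L p)
  orthogonal : ∀ θ : ℝ, lorentzInner (angularDeriv γ θ) (L (Circle.exp θ)) = 0
  nontrivial : (∃ θ : ℝ, angularDeriv γ θ ≠ 0) ∨ (∃ p : Circle, L p ≠ 0)

/-- The open annulus `A(r, R)` centred at the origin. -/
def annulus (r R : ℝ) : Set ℂ := {z | r < ‖z‖ ∧ ‖z‖ < R}

/-- The Wirtinger derivative `f_z = (f_x - i f_y) / 2`. -/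
def wirtinger (f : ℂ → ℂ) (z : ℂ) : ℂ :=
  (fderiv ℝ f z 1 - Complex.I * fderiv ℝ f z Complex.I) / 2

/-- The conjugate Wirtinger derivative `f_{z̄} = (f_x + i f_y) / 2`. -/
def wirtingerBar (f : ℂ → ℂ) (z : ℂ) : ℂ :=
  (fderiv ℝ f z 1 + Complex.I * fderiv ℝ f z Complex.I) / 2

/-- The complex coordinate `h` of `F = (h, w)`. -/
def hCoord (F : ℂ → LorentzSpace) (z : ℂ) : ℂ := (F z).1

/-- The real coordinate `w` of `F = (h, w)`, regarded as a complex-valued function. -/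
def wCoord (F : ℂ → LorentzSpace) (z : ℂ) : ℂ := ((F z).2 : ℂ)

/-- `F = (h, w) : Ω → ℂ × ℝ` is a generalised maximal surface: a smooth harmonic map on a domain,
conformal, with `|h_z|` not identically equal to `|h_{z̄}|`. -/
structure IsGeneralisedMaximalSurface (F : ℂ → LorentzSpace) (Ω : Set ℂ) : Prop where
  isOpen : IsOpen Ω
  isConnected : IsConnected Ω
  smooth : ContDiffOn ℝ ∞ F Ω
  harmonic_h : ∀ z ∈ Ω, wirtingerBar (wirtinger (hCoord F)) z = 0
  harmonic_w : ∀ z ∈ Ω, wirtingerBar (wirtinger (wCoord F)) z = 0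
  conformal : ∀ z ∈ Ω,
    wirtinger (hCoord F) z * conj (wirtingerBar (hCoord F) z) - wirtinger (wCoord F) z ^ 2 = 0
  nondegenerate : ∃ z ∈ Ω, ‖wirtinger (hCoord F) z‖ ≠ ‖wirtingerBar (hCoord F) z‖

/-- The singular set of `(F, Ω)`: the points of `Ω` where `|h_z| = |h_{z̄}|`. -/
def singularSet (F : ℂ → LorentzSpace) (Ω : Set ℂ) : Set ℂ :=
  {z ∈ Ω | ‖wirtinger (hCoord F) z‖ = ‖wirtingerBar (hCoord F) z‖}

/-- `G` is an analytic extension to the annulus `A(r, R)`, `0 < r < 1 < R`, of the map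
`g = √((L₁ + i L₂) / (L₁ - i L₂)) = √((γ₁' + i γ₂') / (γ₁' - i γ₂'))` on the unit circle.
The first formula is used where `L₁ + i L₂ ≠ 0` and the second one where `γ₁' + i γ₂' ≠ 0`;
if `γ'` or `L` vanishes identically, only the other one is left. At the remaining points, which
are isolated, `g` is determined by continuity. The square root is a branch that is analytic along
the whole circle. -/
structure IsGaussExtension (γ L : Circle → LorentzSpace) (r R : ℝ) (G : ℂ → ℂ) : Prop where
  pos : 0 < r
  lt_one : r < 1
  one_lt : 1 < R
  holomorphic : DifferentiableOn ℂ G (annulus r R)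
  sq_field : ∀ θ : ℝ, (L (Circle.exp θ)).1 ≠ 0 →
    G (Circle.exp θ) ^ 2 = (L (Circle.exp θ)).1 / conj (L (Circle.exp θ)).1
  sq_curve : ∀ θ : ℝ, (angularDeriv γ θ).1 ≠ 0 →
    G (Circle.exp θ) ^ 2 = (angularDeriv γ θ).1 / conj (angularDeriv γ θ).1

/-- `F` is a generalised maximal surface on the annulus `A(r, R)`, `0 < r < 1 < R`, with
`F = γ` and `∂F/∂ρ = L` on the unit circle. -/
structure SolvesSingularBjorling (γ L : Circle → LorentzSpace) (r R : ℝ)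
    (F : ℂ → LorentzSpace) : Prop where
  pos : 0 < r
  lt_one : r < 1
  one_lt : 1 < R
  surface : IsGeneralisedMaximalSurface F (annulus r R)
  eq_curve : ∀ p : Circle, F p = γ p
  radial_deriv : ∀ p : Circle, HasDerivAt (fun ρ : ℝ => F ((ρ : ℂ) * p)) (L p) 1

end

/-! Complexifying the analytic data in the angular coordinate, d'Alembert's formula in the
characteristic coordinates `z` and `1 / z̄` solves the Cauchy problem for the Laplace equation with
`F = γ` and `∂F/∂ρ = L` on the circle. Orthogonal null vectors are proportional, so at each point
of the circle `γ'` and `L` are real multiples of one vector `(e, 1)` with `|e| = 1`. Hence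
`h_z = e w_z` and `conj h_{z̄} = ē w_z` on the circle, which gives `|h_z| = |h_{z̄}|` there and, as
`h_z`, `conj h_{z̄}` and `w_z` are holomorphic, conformality near the circle. On the circle
`G² = e²` off the common zeros of `γ'` and `L`, so `G² conj h_{z̄} = h_z` near the circle as well,
and `|h_z| ≡ |h_{z̄}|` would force `|G| ≡ 1`. Uniqueness holds because `h_z` and `w_z` are
holomorphic and `γ` and `L` determine them on the circle. -/

namespace SingularBjorling

open Filter Topology Metric Complex

/-! ### Complexification on the circle -/

section Complexification

variable {E : Type*} [NormedAddCommGroup E] [NormedSpace ℂ E]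

theorem exists_analyticAt_comp_ofReal_eventuallyEq [CompleteSpace E] {f : ℝ → E} {t₀ : ℝ}
    (hf : AnalyticAt ℝ f t₀) :
    ∃ φ : ℂ → E, AnalyticAt ℂ φ t₀ ∧ (fun t : ℝ => φ t) =ᶠ[𝓝 t₀] f := by
  obtain ⟨p, hp⟩ := hf
  let q : FormalMultilinearSeries ℂ ℂ E := fun n =>
    ContinuousMultilinearMap.mkPiRing ℂ (Fin n) (p.coeff n)
  have radius_eq : q.radius = p.radius := by
    simp only [FormalMultilinearSeries.radius, q, ContinuousMultilinearMap.norm_mkPiRing,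
      FormalMultilinearSeries.norm_apply_eq_norm_coef]
  have hq := (q.hasFPowerSeriesOnBall (radius_eq ▸ hp.radius_pos)).comp_sub (t₀ : ℂ)
  rw [zero_add] at hq
  refine ⟨fun z => q.sum (z - t₀), hq.analyticAt, ?_⟩
  filter_upwards [hp.eventually_hasSum_sub] with t ht
  rw [FormalMultilinearSeries.sum, ← ht.tsum_eq]
  refine tsum_congr fun n => ?_
  simp only [q, ContinuousMultilinearMap.mkPiRing_apply, Finset.prod_const, Finset.card_univ,
    Fintype.card_fin, FormalMultilinearSeries.apply_eq_pow_smul_coeff, ← ofReal_sub, ← ofReal_pow,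
    coe_smul]

theorem iteratedDeriv_comp_ofReal [CompleteSpace E] (n : ℕ) {φ : ℂ → E} {t : ℝ}
    (hφ : AnalyticAt ℂ φ t) :
    iteratedDeriv n (fun s : ℝ => φ s) t = iteratedDeriv n φ t := by
  induction n generalizing φ with
  | zero => simp
  | succ n ih =>
    have hderiv : deriv (fun s : ℝ => φ s) =ᶠ[𝓝 t] fun s : ℝ => deriv φ s := by
      filter_upwards [continuous_ofReal.continuousAt.eventually hφ.eventually_analyticAt]
        with s hs
      simpa [Function.comp_def] using
        (hs.differentiableAt.hasDerivAt.scomp s ofRealCLM.hasDerivAt).deriv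
    rw [iteratedDeriv_succ', iteratedDeriv_succ', hderiv.iteratedDeriv_eq, ih hφ.deriv]

/-- The canonical extension of a function of a real variable to the complex plane: at `x + iy`
take the value at `iy` of the Taylor series of `f` at `x`. -/
noncomputable def taylorExtension (f : ℝ → E) (z : ℂ) : E :=
  ∑' n : ℕ, (n.factorial : ℂ)⁻¹ • (z - z.re) ^ n • iteratedDeriv n f z.re

theorem taylorExtension_comp_ofReal_eventuallyEq [CompleteSpace E] {φ : ℂ → E} {t₀ : ℝ}
    (hφ : AnalyticAt ℂ φ t₀) : taylorExtension (fun t : ℝ => φ t) =ᶠ[𝓝 (t₀ : ℂ)] φ := by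
  obtain ⟨ε, hε, hball⟩ := eventually_nhds_iff_ball.1 hφ.eventually_analyticAt
  filter_upwards [ball_mem_nhds (t₀ : ℂ) (half_pos hε)] with z hz
  rw [mem_ball, dist_eq] at hz
  have dist_re : dist (z.re : ℂ) t₀ < ε / 2 := by
    rw [dist_eq, ← ofReal_sub, norm_real]
    simpa using (abs_re_le_norm (z - t₀)).trans_lt hz
  have dist_self_re : dist z z.re < ε / 2 := by
    have im_part : z - z.re = (z - t₀).im * I := by apply Complex.ext <;> simp
    rw [dist_eq, im_part, norm_mul, norm_I, mul_one, norm_real]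
    exact (abs_im_le_norm _).trans_lt hz
  have ball_subset : ball (z.re : ℂ) (ε / 2) ⊆ ball (t₀ : ℂ) ε :=
    ball_subset_ball' (by linarith)
  rw [taylorExtension, ← taylorSeries_eq_on_ball
    (fun w hw => (hball w (ball_subset hw)).differentiableAt.differentiableWithinAt) dist_self_re]
  exact tsum_congr fun n => by
    rw [iteratedDeriv_comp_ofReal n (hball _ (ball_subset (mem_ball_self (half_pos hε))))]

theorem taylorExtension_ofReal (f : ℝ → E) (t : ℝ) : taylorExtension f t = f t := by
  rw [taylorExtension, tsum_eq_single 0 fun n hn => by simp [hn]]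
  simp

theorem taylorExtension_congr {f g : ℝ → E} {t : ℝ} (h : f =ᶠ[𝓝 t] g) :
    taylorExtension f =ᶠ[𝓝 (t : ℂ)] taylorExtension g := by
  have hre : Tendsto re (𝓝 (t : ℂ)) (𝓝 t) := continuous_re.tendsto _
  filter_upwards [hre.eventually h.eventuallyEq_nhds] with z hz
  simp only [taylorExtension, hz.iteratedDeriv_eq]

theorem analyticAt_taylorExtension [CompleteSpace E] {f : ℝ → E} {t : ℝ} (hf : AnalyticAt ℝ f t) :
    AnalyticAt ℂ (taylorExtension f) t := by
  obtain ⟨φ, hφ, hφf⟩ := exists_analyticAt_comp_ofReal_eventuallyEq hf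
  exact hφ.congr ((taylorExtension_congr hφf).symm.trans
    (taylorExtension_comp_ofReal_eventuallyEq hφ)).symm

theorem periodic_taylorExtension {f : ℝ → E} {c : ℝ} (hf : Function.Periodic f c) :
    Function.Periodic (taylorExtension f) c := fun z => by
  have hderiv (n : ℕ) : iteratedDeriv n f (z.re + c) = iteratedDeriv n f z.re := by
    rw [← congrFun (iteratedDeriv_comp_add_const n f c) z.re, hf.funext]
  simp only [taylorExtension, add_re, ofReal_re, ofReal_add, add_sub_add_right_eq_sub, hderiv]

end Complexification

open Function.Periodic in
theorem analyticAt_cuspFunction {f : ℂ → ℂ} {c : ℝ} {z : ℂ} (hc : c ≠ 0)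
    (hper : Function.Periodic f c) (hf : AnalyticAt ℂ f z) :
    AnalyticAt ℂ (cuspFunction c f) (qParam c z) := by
  have hderiv : HasStrictDerivAt (qParam c) (qParam c z * (2 * Real.pi * I / c)) z := by
    simpa only [id_eq, mul_one] using! (((hasStrictDerivAt_id z).const_mul _).div_const _).cexp
  have hderiv_ne : qParam c z * (2 * Real.pi * I / c) ≠ 0 :=
    mul_ne_zero (Complex.exp_ne_zero _) (div_ne_zero two_pi_I_ne_zero (ofReal_ne_zero.2 hc))
  rw [analyticAt_iff_eventually_differentiableAt, ← hderiv.map_nhds_eq hderiv_ne, eventually_map]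
  exact hf.eventually_analyticAt.mono fun w hw =>
    differentiableAt_cuspFunction hc hper hw.differentiableAt

theorem exists_analyticAt_circle_extension {f : ℝ → ℂ} (hf : ∀ t, AnalyticAt ℝ f t)
    (hper : Function.Periodic f (2 * Real.pi)) :
    ∃ φ : ℂ → ℂ, (∀ p : Circle, AnalyticAt ℂ φ p) ∧ ∀ t : ℝ, φ (Circle.exp t) = f t := by
  have qParam_ofReal (t : ℝ) : Function.Periodic.qParam (2 * Real.pi) t = Circle.exp t := by
    have pi_ne_zero : (Real.pi : ℂ) ≠ 0 := ofReal_ne_zero.2 Real.pi_ne_zero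
    rw [Function.Periodic.qParam, Circle.coe_exp]
    push_cast
    field_simp
  have hper' := periodic_taylorExtension hper
  refine ⟨Function.Periodic.cuspFunction (2 * Real.pi) (taylorExtension f), fun p => ?_,
    fun t => ?_⟩
  · rw [← Circle.exp_arg p, ← qParam_ofReal]
    exact analyticAt_cuspFunction Real.two_pi_pos.ne' hper' (analyticAt_taylorExtension (hf _))
  · rw [← qParam_ofReal, Function.Periodic.eq_cuspFunction Real.two_pi_pos.ne' hper',
      taylorExtension_ofReal]

/-! ### Annuli around the circle -/

theorem isOpen_annulus (r R : ℝ) : IsOpen (annulus r R) :=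
  (isOpen_lt continuous_const continuous_norm).inter (isOpen_lt continuous_norm continuous_const)

theorem annulus_eq_image_exp {r R : ℝ} (hr : 0 < r) (hR : 0 < R) :
    annulus r R = Complex.exp '' (Complex.re ⁻¹' Set.Ioo (Real.log r) (Real.log R)) := by
  ext z
  constructor
  · intro hz
    have norm_pos : 0 < ‖z‖ := hr.trans hz.1
    refine ⟨Complex.log z, ?_, Complex.exp_log (norm_pos_iff.1 norm_pos)⟩
    rw [Set.mem_preimage, Complex.log_re]
    exact ⟨Real.log_lt_log hr hz.1, Real.log_lt_log norm_pos hz.2⟩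
  · rintro ⟨w, hw, rfl⟩
    rw [annulus, Set.mem_ofPred_eq, Complex.norm_exp]
    exact ⟨(Real.log_lt_iff_lt_exp hr).1 hw.1, (Real.lt_log_iff_exp_lt hR).1 hw.2⟩

theorem isPreconnected_annulus {r R : ℝ} (hr : 0 < r) (hR : 0 < R) :
    IsPreconnected (annulus r R) := by
  rw [annulus_eq_image_exp hr hR]
  exact (((convex_Ioo _ _).is_linear_preimage
    Complex.reLm.isLinear).isPreconnected).image _ Complex.continuous_exp.continuousOn

theorem circle_mem_annulus {r R : ℝ} (hr : r < 1) (hR : 1 < R) (p : Circle) :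
    (p : ℂ) ∈ annulus r R :=
  ⟨by rwa [Circle.norm_coe], by rwa [Circle.norm_coe]⟩

theorem annulus_inter (r R r' R' : ℝ) :
    annulus r R ∩ annulus r' R' = annulus (max r r') (min R R') := by
  ext z
  simp only [annulus, Set.mem_inter_iff, Set.mem_ofPred_eq, max_lt_iff, lt_min_iff]
  tauto

theorem exists_annulus_of_forall_circle {P : ℂ → Prop}
    (hP : ∀ p : Circle, ∀ᶠ z in 𝓝 (p : ℂ), P z) :
    ∃ r R : ℝ, 0 < r ∧ r < 1 ∧ 1 < R ∧ ∀ z ∈ annulus r R, P z := by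
  have sphere_subset : sphere (0 : ℂ) 1 ⊆ interior {z | P z} := fun z hz =>
    mem_interior_iff_mem_nhds.2 (hP ⟨z, hz⟩)
  obtain ⟨δ, hδ, hthick⟩ :=
    (isCompact_sphere (0 : ℂ) 1).exists_thickening_subset_open isOpen_interior sphere_subset
  refine ⟨max (1 - δ) (1 / 2), 1 + δ, by positivity, max_lt (by linarith) (by norm_num),
    by linarith, fun z hz => ?_⟩
  obtain ⟨lower, half_lt⟩ := max_lt_iff.1 hz.1
  have norm_ne : (‖z‖ : ℂ) ≠ 0 := ofReal_ne_zero.2 (by linarith)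
  have radial : z - z / ‖z‖ = z / ‖z‖ * ((‖z‖ - 1 : ℝ) : ℂ) := by
    push_cast
    field_simp
  have unit : ‖z / ‖z‖‖ = 1 := by
    rw [norm_div, norm_real, norm_norm, div_self (by linarith)]
  refine interior_subset (hthick (mem_thickening_iff.2 ⟨z / ‖z‖, by simpa using unit, ?_⟩))
  rw [dist_eq, radial, norm_mul, unit, one_mul, norm_real, Real.norm_eq_abs, abs_lt]
  exact ⟨by linarith, by linarith [hz.2]⟩

theorem frequently_nhdsNE_of_forall_circle {P : ℂ → Prop} (hP : ∀ p : Circle, P p) (p : Circle) :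
    ∃ᶠ z in 𝓝[≠] (p : ℂ), P z := by
  have hsphere : Preperfect (sphere (0 : ℂ) 1) :=
    (isPreconnected_sphere (by simp [rank_real_complex]) 0 1).preperfect_of_nontrivial
      ⟨1, by simp, -1, by simp, by norm_num⟩
  exact (accPt_iff_frequently_nhdsNE.1 (hsphere _ p.2)).mono fun z hz => hP ⟨z, hz⟩

theorem eventuallyEq_of_eq_on_circle {f g : ℂ → ℂ} {p : Circle} (hf : AnalyticAt ℂ f p)
    (hg : AnalyticAt ℂ g p) (hfg : ∀ q : Circle, f q = g q) : f =ᶠ[𝓝 (p : ℂ)] g :=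
  (hf.frequently_eq_iff_eventually_eq hg).1 (frequently_nhdsNE_of_forall_circle hfg p)

theorem eqOn_annulus_of_eq_on_circle {f g : ℂ → ℂ} {r R : ℝ} (hr : 0 < r) (hr1 : r < 1)
    (hR : 1 < R) (hf : DifferentiableOn ℂ f (annulus r R))
    (hg : DifferentiableOn ℂ g (annulus r R)) (hfg : ∀ q : Circle, f q = g q) :
    Set.EqOn f g (annulus r R) :=
  (hf.analyticOnNhd (isOpen_annulus r R)).eqOn_of_preconnected_of_frequently_eq
    (hg.analyticOnNhd (isOpen_annulus r R)) (isPreconnected_annulus hr (by linarith))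
    (circle_mem_annulus hr1 hR 1) (frequently_nhdsNE_of_forall_circle hfg 1)

theorem norm_eq_of_eventually_norm_eq {E : Type*} [NormedAddCommGroup E] [NormedSpace ℂ E]
    [StrictConvexSpace ℝ E] [CompleteSpace E] {f : ℂ → E} {U : Set ℂ} {c : ℂ} {C : ℝ}
    (hU : IsOpen U) (hconn : IsPreconnected U) (hf : DifferentiableOn ℂ f U) (hc : c ∈ U)
    (hnorm : ∀ᶠ z in 𝓝 c, ‖f z‖ = C) : ∀ z ∈ U, ‖f z‖ = C := by
  have norm_center := hnorm.self_of_nhds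
  have locally_const : f =ᶠ[𝓝 c] fun _ => f c := eventually_eq_of_isLocalMax_norm
    ((hU.eventually_mem hc).mono fun z hz => hf.differentiableAt (hU.mem_nhds hz))
    (hnorm.mono fun z hz => (hz.trans norm_center.symm).le)
  have const := (hf.analyticOnNhd hU).eqOn_of_preconnected_of_eventuallyEq
    (fun _ _ => analyticAt_const) hconn hc locally_const
  exact fun z hz => by rw [const hz, norm_center]

/-! ### Wirtinger derivatives and Cauchy data -/

theorem fderiv_apply_eq_wirtinger (f : ℂ → ℂ) (z v : ℂ) :
    fderiv ℝ f z v = wirtinger f z * v + wirtingerBar f z * conj v := by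
  have coordinates : v = v.re • (1 : ℂ) + v.im • I := by simp [re_add_im]
  have conj_coordinates : conj v = v.re - v.im * I := by apply Complex.ext <;> simp
  have expansion : fderiv ℝ f z v = v.re * fderiv ℝ f z 1 + v.im * fderiv ℝ f z I := by
    conv_lhs => rw [coordinates]
    rw [map_add, map_smul, map_smul, real_smul, real_smul]
  rw [expansion, conj_coordinates, wirtinger, wirtingerBar]
  nth_rewrite 3 [← re_add_im v]
  linear_combination (v.im : ℂ) * fderiv ℝ f z I * I_mul_I

theorem differentiableAt_iff_wirtingerBar_eq_zero {f : ℂ → ℂ} {z : ℂ} :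
    DifferentiableAt ℂ f z ↔ DifferentiableAt ℝ f z ∧ wirtingerBar f z = 0 := by
  rw [differentiableAt_complex_iff_differentiableAt_real, wirtingerBar, smul_eq_mul,
    div_eq_zero_iff, or_iff_left two_ne_zero]
  refine and_congr_right fun _ => ⟨fun h => ?_, fun h => ?_⟩
  · linear_combination I * h + fderiv ℝ f z 1 * I_mul_I
  · linear_combination -I * h + fderiv ℝ f z I * I_mul_I

theorem wirtinger_sub {f g : ℂ → ℂ} {z : ℂ} (hf : DifferentiableAt ℝ f z)
    (hg : DifferentiableAt ℝ g z) :
    wirtinger (fun w => f w - g w) z = wirtinger f z - wirtinger g z := by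
  rw [wirtinger, fderiv_fun_sub hf hg, wirtinger, wirtinger, sub_apply, sub_apply]
  ring

theorem wirtingerBar_conj (f : ℂ → ℂ) (z : ℂ) :
    wirtingerBar (fun w => conj (f w)) z = conj (wirtinger f z) := by
  have fderiv_conj (v : ℂ) : fderiv ℝ (fun w => conj (f w)) z v = conj (fderiv ℝ f z v) :=
    congrArg (· v) (conjCLE.comp_fderiv (f := f) (x := z))
  simp only [wirtingerBar, wirtinger, fderiv_conj, map_div₀, map_sub, map_mul, conj_I,
    conj_ofNat]
  ring

theorem fderiv_add_conj_apply {A B : ℂ → ℂ} {z : ℂ} (hA : DifferentiableAt ℂ A z)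
    (hB : DifferentiableAt ℂ B z) (v : ℂ) :
    fderiv ℝ (fun w => A w + conj (B w)) z v = deriv A z * v + conj (deriv B z * v) := by
  have hderiv := (hA.hasDerivAt.hasFDerivAt.restrictScalars ℝ).add
    ((conjCLE : ℂ →L[ℝ] ℂ).hasFDerivAt.comp z (hB.hasDerivAt.hasFDerivAt.restrictScalars ℝ))
  refine (congrArg (· v) hderiv.fderiv).trans ?_
  simp [mul_comm]

theorem wirtinger_add_conj {A B : ℂ → ℂ} {z : ℂ} (hA : DifferentiableAt ℂ A z)
    (hB : DifferentiableAt ℂ B z) : wirtinger (fun w => A w + conj (B w)) z = deriv A z := by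
  rw [wirtinger, fderiv_add_conj_apply hA hB, fderiv_add_conj_apply hA hB]
  simp only [map_mul, conj_I, mul_one]
  linear_combination (-deriv A z / 2 + conj (deriv B z) / 2) * I_mul_I

theorem wirtingerBar_add_conj {A B : ℂ → ℂ} {z : ℂ} (hA : DifferentiableAt ℂ A z)
    (hB : DifferentiableAt ℂ B z) :
    wirtingerBar (fun w => A w + conj (B w)) z = conj (deriv B z) := by
  rw [← wirtinger_add_conj hB hA, ← wirtingerBar_conj]
  simp only [map_add, conj_conj, add_comm]

theorem contDiffOn_wirtinger {f : ℂ → ℂ} {U : Set ℂ} (hU : IsOpen U) (hf : ContDiffOn ℝ ∞ f U) :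
    ContDiffOn ℝ ∞ (wirtinger f) U := by
  have h : ContDiffOn ℝ ∞ (fderiv ℝ f) U := hf.fderiv_of_isOpen hU (by simp)
  exact ((h.clm_apply contDiffOn_const).sub
    (contDiffOn_const.mul (h.clm_apply contDiffOn_const))).div_const 2

theorem differentiableOn_wirtinger {f : ℂ → ℂ} {U : Set ℂ} (hU : IsOpen U)
    (hf : ContDiffOn ℝ ∞ f U) (hharm : ∀ z ∈ U, wirtingerBar (wirtinger f) z = 0) :
    DifferentiableOn ℂ (wirtinger f) U := fun z hz =>
  (differentiableAt_iff_wirtingerBar_eq_zero.2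
    ⟨((contDiffOn_wirtinger hU hf).contDiffAt (hU.mem_nhds hz)).differentiableAt (by simp),
      hharm z hz⟩).differentiableWithinAt

theorem hasDerivAt_ofReal_mul (p : ℂ) (t : ℝ) : HasDerivAt (fun ρ : ℝ => (ρ : ℂ) * p) p t := by
  simpa using (hasDerivAt_id t).ofReal_comp.mul_const p

theorem hasDerivAt_circleExp (θ : ℝ) :
    HasDerivAt (fun t : ℝ => (Circle.exp t : ℂ)) (I * Circle.exp θ) θ := by
  have hexp : HasDerivAt (fun z : ℂ => Complex.exp (z * I)) (Complex.exp (θ * I) * I) θ := by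
    simpa using ((hasDerivAt_id (θ : ℂ)).mul_const I).cexp
  simpa [Circle.coe_exp, mul_comm] using hexp.comp_ofReal

section CauchyData

variable {h : ℂ → ℂ} {f' l : ℂ} {θ : ℝ}

theorem fderiv_tangential (hh : DifferentiableAt ℝ h (Circle.exp θ))
    (hf : HasDerivAt (fun t : ℝ => h (Circle.exp t)) f' θ) :
    fderiv ℝ h (Circle.exp θ) (I * Circle.exp θ) = f' :=
  (hh.hasFDerivAt.comp_hasDerivAt θ (hasDerivAt_circleExp θ)).unique hf

theorem fderiv_radial {p : Circle} (hh : DifferentiableAt ℝ h p)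
    (hl : HasDerivAt (fun ρ : ℝ => h (ρ * p)) l 1) : fderiv ℝ h p p = l := by
  have hh' : HasFDerivAt h (fderiv ℝ h p) (((1 : ℝ) : ℂ) * p) := by simpa using hh.hasFDerivAt
  exact (hh'.comp_hasDerivAt (1 : ℝ) (hasDerivAt_ofReal_mul p 1)).unique hl

theorem wirtinger_mul_circleExp (hh : DifferentiableAt ℝ h (Circle.exp θ))
    (hf : HasDerivAt (fun t : ℝ => h (Circle.exp t)) f' θ)
    (hl : HasDerivAt (fun ρ : ℝ => h (ρ * Circle.exp θ)) l 1) :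
    wirtinger h (Circle.exp θ) * Circle.exp θ = (l - I * f') / 2 := by
  rw [← fderiv_tangential hh hf, ← fderiv_radial hh hl, fderiv_apply_eq_wirtinger,
    fderiv_apply_eq_wirtinger, map_mul, conj_I]
  linear_combination (wirtinger h (Circle.exp θ) * Circle.exp θ -
    wirtingerBar h (Circle.exp θ) * conj (Circle.exp θ : ℂ)) / 2 * I_mul_I

theorem conj_wirtingerBar_mul_circleExp (hh : DifferentiableAt ℝ h (Circle.exp θ))
    (hf : HasDerivAt (fun t : ℝ => h (Circle.exp t)) f' θ)
    (hl : HasDerivAt (fun ρ : ℝ => h (ρ * Circle.exp θ)) l 1) :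
    conj (wirtingerBar h (Circle.exp θ)) * Circle.exp θ = (conj l - I * conj f') / 2 := by
  have radial := fderiv_radial hh hl
  rw [fderiv_apply_eq_wirtinger, ← eq_sub_iff_add_eq', wirtinger_mul_circleExp hh hf hl] at radial
  have radial_conj := congrArg conj radial
  simp only [map_mul, conj_conj, map_sub, map_div₀, conj_I, conj_ofNat] at radial_conj
  linear_combination radial_conj

end CauchyData

theorem wirtinger_eq_of_cauchyData {h₁ h₂ : ℂ → ℂ} {l : ℂ} {p : Circle}
    (hh₁ : DifferentiableAt ℝ h₁ p) (hh₂ : DifferentiableAt ℝ h₂ p)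
    (trace : ∀ q : Circle, h₁ q = h₂ q) (radial₁ : HasDerivAt (fun ρ : ℝ => h₁ (ρ * p)) l 1)
    (radial₂ : HasDerivAt (fun ρ : ℝ => h₂ (ρ * p)) l 1) : wirtinger h₁ p = wirtinger h₂ p := by
  obtain ⟨θ, rfl⟩ := Circle.exp_surjective p
  have tangential₁ := hh₁.hasFDerivAt.comp_hasDerivAt θ (hasDerivAt_circleExp θ)
  have tangential₂ := tangential₁.congr_of_eventuallyEq
    (.of_forall fun t => (trace (Circle.exp t)).symm)
  refine mul_right_cancel₀ (Circle.coe_ne_zero (Circle.exp θ)) ?_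
  rw [wirtinger_mul_circleExp hh₁ tangential₁ radial₁,
    wirtinger_mul_circleExp hh₂ tangential₂ radial₂]

theorem eqOn_annulus_of_cauchyData {h₁ h₂ : ℂ → ℂ} {l : Circle → ℂ} {r R : ℝ} (hr : 0 < r)
    (hr1 : r < 1) (hR : 1 < R) (smooth₁ : ContDiffOn ℝ ∞ h₁ (annulus r R))
    (smooth₂ : ContDiffOn ℝ ∞ h₂ (annulus r R))
    (harm₁ : ∀ z ∈ annulus r R, wirtingerBar (wirtinger h₁) z = 0)
    (harm₂ : ∀ z ∈ annulus r R, wirtingerBar (wirtinger h₂) z = 0)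
    (trace : ∀ p : Circle, h₁ p = h₂ p)
    (radial₁ : ∀ p : Circle, HasDerivAt (fun ρ : ℝ => h₁ (ρ * p)) (l p) 1)
    (radial₂ : ∀ p : Circle, HasDerivAt (fun ρ : ℝ => h₂ (ρ * p)) (l p) 1) :
    Set.EqOn h₁ h₂ (annulus r R) := by
  have isOpen := isOpen_annulus r R
  have differentiable₁ (z) (hz : z ∈ annulus r R) : DifferentiableAt ℝ h₁ z :=
    (smooth₁.contDiffAt (isOpen.mem_nhds hz)).differentiableAt (by simp)
  have differentiable₂ (z) (hz : z ∈ annulus r R) : DifferentiableAt ℝ h₂ z :=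
    (smooth₂.contDiffAt (isOpen.mem_nhds hz)).differentiableAt (by simp)
  have wirtinger_eq : Set.EqOn (wirtinger h₁) (wirtinger h₂) (annulus r R) := by
    refine eqOn_annulus_of_eq_on_circle hr hr1 hR (differentiableOn_wirtinger isOpen smooth₁ harm₁)
      (differentiableOn_wirtinger isOpen smooth₂ harm₂) fun p => ?_
    have mem := circle_mem_annulus hr1 hR p
    exact wirtinger_eq_of_cauchyData (differentiable₁ p mem) (differentiable₂ p mem) trace
      (radial₁ p) (radial₂ p)
  have conj_sub_holomorphic :
      DifferentiableOn ℂ (fun z => conj (h₁ z - h₂ z)) (annulus r R) := fun z hz => by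
    refine (differentiableAt_iff_wirtingerBar_eq_zero.2 ⟨?_, ?_⟩).differentiableWithinAt
    · exact conjCLE.differentiableAt.comp z ((differentiable₁ z hz).sub (differentiable₂ z hz))
    · rw [wirtingerBar_conj, wirtinger_sub (differentiable₁ z hz) (differentiable₂ z hz),
        wirtinger_eq hz, sub_self, map_zero]
  have conj_sub_eq_zero := eqOn_annulus_of_eq_on_circle hr hr1 hR conj_sub_holomorphic
    (differentiableOn_const 0) fun p => by rw [trace, sub_self, map_zero]
  exact fun z hz => sub_eq_zero.1 ((map_eq_zero _).1 (conj_sub_eq_zero hz))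

/-- `h` is harmonic at `z`, in the form of a local decomposition of `h` into the sum of a
holomorphic and an antiholomorphic function. -/
def IsComplexHarmonicAt (h : ℂ → ℂ) (z : ℂ) : Prop :=
  ∃ A B : ℂ → ℂ, AnalyticAt ℂ A z ∧ AnalyticAt ℂ B z ∧ h =ᶠ[𝓝 z] fun w => A w + conj (B w)

namespace IsComplexHarmonicAt

variable {h : ℂ → ℂ} {z : ℂ}

theorem eventually (hh : IsComplexHarmonicAt h z) : ∀ᶠ w in 𝓝 z, IsComplexHarmonicAt h w := by
  obtain ⟨A, B, hA, hB, heq⟩ := hh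
  filter_upwards [hA.eventually_analyticAt, hB.eventually_analyticAt, heq.eventuallyEq_nhds]
    with w hAw hBw hw using ⟨A, B, hAw, hBw, hw⟩

theorem contDiffAt (hh : IsComplexHarmonicAt h z) : ContDiffAt ℝ ∞ h z := by
  obtain ⟨A, B, hA, hB, heq⟩ := hh
  exact ((hA.contDiffAt.restrict_scalars ℝ).add
    (conjCLE.contDiff.contDiffAt.comp z (hB.contDiffAt.restrict_scalars ℝ))).congr_of_eventuallyEq
      heq

theorem differentiableAt (hh : IsComplexHarmonicAt h z) : DifferentiableAt ℝ h z :=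
  hh.contDiffAt.differentiableAt (by simp)

theorem analyticAt_wirtinger (hh : IsComplexHarmonicAt h z) : AnalyticAt ℂ (wirtinger h) z := by
  obtain ⟨A, B, hA, hB, heq⟩ := hh
  refine hA.deriv.congr ?_
  filter_upwards [hA.eventually_analyticAt, hB.eventually_analyticAt, heq.eventuallyEq_nhds]
    with w hAw hBw hw
  rw [← wirtinger_add_conj hAw.differentiableAt hBw.differentiableAt, wirtinger, wirtinger,
    hw.fderiv_eq]

theorem analyticAt_conj_wirtingerBar (hh : IsComplexHarmonicAt h z) :
    AnalyticAt ℂ (fun w => conj (wirtingerBar h w)) z := by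
  obtain ⟨A, B, hA, hB, heq⟩ := hh
  refine hB.deriv.congr ?_
  filter_upwards [hA.eventually_analyticAt, hB.eventually_analyticAt, heq.eventuallyEq_nhds]
    with w hAw hBw hw
  rw [← conj_conj (deriv B w), ← wirtingerBar_add_conj hAw.differentiableAt hBw.differentiableAt,
    wirtingerBar, wirtingerBar, hw.fderiv_eq]

theorem wirtingerBar_wirtinger (hh : IsComplexHarmonicAt h z) :
    wirtingerBar (wirtinger h) z = 0 :=
  (differentiableAt_iff_wirtingerBar_eq_zero.1 hh.analyticAt_wirtinger.differentiableAt).2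

theorem ofReal_re (hh : IsComplexHarmonicAt h z) :
    IsComplexHarmonicAt (fun w => ((h w).re : ℂ)) z := by
  obtain ⟨A, B, hA, hB, heq⟩ := hh
  have hAB : AnalyticAt ℂ (fun w => (A w + B w) / 2) z := (hA.add hB).div_const
  refine ⟨_, _, hAB, hAB, heq.mono fun w hw => ?_⟩
  simp only [hw, re_eq_add_conj, map_add, map_div₀, conj_conj, conj_ofNat]
  ring

end IsComplexHarmonicAt

/-! ### The Cauchy problem for the Laplace equation -/

section Reflection

/-- Reflection `z ↦ 1 / conj z` in the unit circle, with value `0` at the origin. -/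
noncomputable def circleReflection (z : ℂ) : ℂ := (conj z)⁻¹

theorem circleReflection_real_mul_circle (ρ : ℝ) (p : Circle) :
    circleReflection (ρ * p) = (ρ⁻¹ : ℝ) * p := by
  rw [circleReflection, map_mul, conj_ofReal, mul_inv, ← Circle.coe_inv_eq_conj, ← Circle.coe_inv,
    inv_inv, ofReal_inv]

theorem circleReflection_circle (p : Circle) : circleReflection p = p := by
  simpa using circleReflection_real_mul_circle 1 p

theorem tendsto_circleReflection (p : Circle) : Tendsto circleReflection (𝓝 p) (𝓝 p) := by
  have hcont : ContinuousAt circleReflection p :=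
    continuous_conj.continuousAt.inv₀ ((map_ne_zero _).2 (Circle.coe_ne_zero p))
  simpa only [ContinuousAt, circleReflection_circle] using hcont

theorem differentiableAt_conj_comp_circleReflection {f : ℂ → ℂ} {z : ℂ} (hz : z ≠ 0)
    (hf : DifferentiableAt ℂ f (circleReflection z)) :
    DifferentiableAt ℂ (fun w => conj (f (circleReflection w))) z := by
  have hconj : DifferentiableAt ℂ (conj ∘ f ∘ conj) z⁻¹ := by
    simpa [circleReflection] using hf.conj_conj
  simpa [Function.comp_def, circleReflection] using hconj.comp z (differentiableAt_inv hz)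

theorem analyticAt_conj_comp_circleReflection {f : ℂ → ℂ} {p : Circle} (hf : AnalyticAt ℂ f p) :
    AnalyticAt ℂ (fun w => conj (f (circleReflection w))) p := by
  rw [analyticAt_iff_eventually_differentiableAt]
  filter_upwards [(tendsto_circleReflection p).eventually hf.eventually_analyticAt,
    eventually_ne_nhds (Circle.coe_ne_zero p)] with w hw hw0 using
    differentiableAt_conj_comp_circleReflection hw0 hw.differentiableAt

end Reflection

theorem exists_primitive_segment {g : ℂ → ℂ} {c : ℂ} (hg : AnalyticAt ℂ g c) :
    ∃ Λ : ℂ → ℂ, ∃ ε > 0, AnalyticAt ℂ Λ c ∧ deriv Λ c = g c ∧ ∀ z ∈ ball c ε, ∀ w ∈ ball c ε,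
      (z - w) * ∫ t in (0 : ℝ)..1, g (w + t * (z - w)) = Λ z - Λ w := by
  obtain ⟨ε, hε, hball⟩ := eventually_nhds_iff_ball.1 hg.eventually_analyticAt
  have hdiff : DifferentiableOn ℂ g (ball c ε) := fun z hz =>
    (hball z hz).differentiableAt.differentiableWithinAt
  obtain ⟨Λ, hΛ⟩ := hdiff.isExactOn_ball
  have center_mem := mem_ball_self (x := c) hε
  refine ⟨Λ, ε, hε, ?_, (hΛ c center_mem).deriv, fun z hz w hw => ?_⟩
  · exact DifferentiableOn.analyticAt
      (fun z hz => (hΛ z hz).differentiableAt.differentiableWithinAt) (ball_mem_nhds c hε)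
  have segment (t : ℝ) (ht : t ∈ Set.Icc (0 : ℝ) 1) : w + t • (z - w) ∈ ball c ε :=
    (convex_ball c ε).add_smul_sub_mem hw hz ht
  have hcont : ContinuousOn (fun t : ℝ => g (w + t • (z - w))) (Set.Icc 0 1) :=
    hdiff.continuousOn.comp (by fun_prop) segment
  simpa only [smul_eq_mul, real_smul, add_sub_cancel] using
    intervalIntegral.integral_unitInterval_deriv_eq_sub hcont fun t ht => hΛ _ (segment t ht)

section CauchyProblem

/-- The solution near the unit circle of the Cauchy problem for the Laplace equation with data
`φ` and `p g(p)`, the radial derivative. This is d'Alembert's formula, in which `z` and its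
reflection `z*` are the characteristic coordinates, with the integral of `g` running over the
segment from `z*` to `z`. -/
noncomputable def cauchySolution (φ g : ℂ → ℂ) (z : ℂ) : ℂ :=
  (φ z + φ (circleReflection z)) / 2 + (z - circleReflection z) / 2 *
    ∫ t in (0 : ℝ)..1, g (circleReflection z + t * (z - circleReflection z))

variable {φ g : ℂ → ℂ} {p : Circle}

theorem cauchySolution_circle (φ g : ℂ → ℂ) (p : Circle) : cauchySolution φ g p = φ p := by
  simp [cauchySolution, circleReflection_circle]

theorem exists_cauchySolution_eventuallyEq (φ : ℂ → ℂ) (hg : AnalyticAt ℂ g p) :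
    ∃ Λ : ℂ → ℂ, AnalyticAt ℂ Λ p ∧ deriv Λ p = g p ∧ cauchySolution φ g =ᶠ[𝓝 (p : ℂ)] fun z =>
      (φ z + Λ z) / 2 + (φ (circleReflection z) - Λ (circleReflection z)) / 2 := by
  obtain ⟨Λ, ε, hε, hΛ, hderiv, hsegment⟩ := exists_primitive_segment hg
  refine ⟨Λ, hΛ, hderiv, ?_⟩
  filter_upwards [ball_mem_nhds _ hε,
    (tendsto_circleReflection p).eventually (ball_mem_nhds _ hε)] with z hz hz'
  rw [cauchySolution]
  linear_combination hsegment z hz _ hz' / 2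

theorem isComplexHarmonicAt_cauchySolution (hφ : AnalyticAt ℂ φ p) (hg : AnalyticAt ℂ g p) :
    IsComplexHarmonicAt (cauchySolution φ g) p := by
  obtain ⟨Λ, hΛ, -, heq⟩ := exists_cauchySolution_eventuallyEq φ hg
  refine ⟨fun z => (φ z + Λ z) / 2,
    fun z => conj ((φ (circleReflection z) - Λ (circleReflection z)) / 2), (hφ.add hΛ).div_const,
    analyticAt_conj_comp_circleReflection (f := fun z => (φ z - Λ z) / 2)
      ((hφ.sub hΛ).div_const), ?_⟩
  simpa only [conj_conj] using heq

theorem hasDerivAt_cauchySolution_radial (hφ : AnalyticAt ℂ φ p) (hg : AnalyticAt ℂ g p) :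
    HasDerivAt (fun ρ : ℝ => cauchySolution φ g (ρ * p)) (p * g p) 1 := by
  obtain ⟨Λ, hΛ, hderiv, heq⟩ := exists_cauchySolution_eventuallyEq φ hg
  have reflected_ray : HasDerivAt (fun ρ : ℝ => ((ρ⁻¹ : ℝ) : ℂ) * p) (-p : ℂ) 1 := by
    simpa using (hasDerivAt_inv (one_ne_zero (α := ℝ))).ofReal_comp.mul_const (p : ℂ)
  have along_ray {f : ℂ → ℂ} (hf : AnalyticAt ℂ f p) :
      HasDerivAt (fun ρ : ℝ => f (ρ * p)) (deriv f p * p) 1 :=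
    HasDerivAt.comp (1 : ℝ) (by simpa using hf.differentiableAt.hasDerivAt)
      (hasDerivAt_ofReal_mul p 1)
  have along_reflected_ray {f : ℂ → ℂ} (hf : AnalyticAt ℂ f p) :
      HasDerivAt (fun ρ : ℝ => f ((ρ⁻¹ : ℝ) * p)) (deriv f p * -p) 1 :=
    HasDerivAt.comp (1 : ℝ) (by simpa using hf.differentiableAt.hasDerivAt) reflected_ray
  have hsum := (((along_ray hφ).add (along_ray hΛ)).div_const 2).add
    (((along_reflected_ray hφ).sub (along_reflected_ray hΛ)).div_const 2)
  have ray_tendsto : Tendsto (fun ρ : ℝ => (ρ : ℂ) * p) (𝓝 1) (𝓝 p) := by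
    simpa using (hasDerivAt_ofReal_mul p 1).continuousAt.tendsto
  refine (hsum.congr_deriv (by rw [hderiv]; ring)).congr_of_eventuallyEq ?_
  filter_upwards [ray_tendsto.eventually heq] with ρ hρ
  simpa only [circleReflection_real_mul_circle] using! hρ

end CauchyProblem

theorem exists_isComplexHarmonicAt_cauchyData {f l : ℝ → ℂ} (hf : ∀ t, AnalyticAt ℝ f t)
    (hf_per : Function.Periodic f (2 * Real.pi)) (hl : ∀ t, AnalyticAt ℝ l t)
    (hl_per : Function.Periodic l (2 * Real.pi)) :
    ∃ h : ℂ → ℂ, (∀ p : Circle, IsComplexHarmonicAt h p) ∧ (∀ t : ℝ, h (Circle.exp t) = f t) ∧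
      ∀ t : ℝ, HasDerivAt (fun ρ : ℝ => h (ρ * Circle.exp t)) (l t) 1 := by
  obtain ⟨φ, hφ, hφf⟩ := exists_analyticAt_circle_extension hf hf_per
  obtain ⟨m, hm, hml⟩ := exists_analyticAt_circle_extension hl hl_per
  have hg (p : Circle) : AnalyticAt ℂ (fun z => m z / z) p :=
    (hm p).div analyticAt_id (Circle.coe_ne_zero p)
  refine ⟨cauchySolution φ fun z => m z / z,
    fun p => isComplexHarmonicAt_cauchySolution (hφ p) (hg p),
    fun t => by rw [cauchySolution_circle, hφf], fun t => ?_⟩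
  refine (hasDerivAt_cauchySolution_radial (hφ _) (hg _)).congr_deriv ?_
  rw [mul_div_cancel₀ _ (Circle.coe_ne_zero _), hml]

/-! ### Uniqueness -/

section Coordinates

variable {F : ℂ → LorentzSpace} {U : Set ℂ} {f : ℝ → LorentzSpace} {f' : LorentzSpace} {t : ℝ}

theorem contDiffOn_hCoord (hF : ContDiffOn ℝ ∞ F U) : ContDiffOn ℝ ∞ (hCoord F) U :=
  contDiff_fst.comp_contDiffOn hF

theorem contDiffOn_wCoord (hF : ContDiffOn ℝ ∞ F U) : ContDiffOn ℝ ∞ (wCoord F) U :=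
  ofRealCLM.contDiff.comp_contDiffOn (contDiff_snd.comp_contDiffOn hF)

theorem hasDerivAt_fst (hf : HasDerivAt f f' t) : HasDerivAt (fun t => (f t).1) f'.1 t :=
  (ContinuousLinearMap.fst ℝ ℂ ℝ).hasFDerivAt.comp_hasDerivAt t hf

theorem hasDerivAt_ofReal_snd (hf : HasDerivAt f f' t) :
    HasDerivAt (fun t => ((f t).2 : ℂ)) f'.2 t :=
  ((ContinuousLinearMap.snd ℝ ℂ ℝ).hasFDerivAt.comp_hasDerivAt t hf).ofReal_comp

end Coordinates

theorem eqOn_of_solvesSingularBjorling {γ L : Circle → LorentzSpace} {r R r' R' : ℝ}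
    {F F' : ℂ → LorentzSpace} (hF : SolvesSingularBjorling γ L r R F)
    (hF' : SolvesSingularBjorling γ L r' R' F') :
    Set.EqOn F' F (annulus r R ∩ annulus r' R') := by
  have inter_eq := annulus_inter r R r' R'
  have subset : annulus (max r r') (min R R') ⊆ annulus r R := inter_eq ▸ Set.inter_subset_left
  have subset' : annulus (max r r') (min R R') ⊆ annulus r' R' := inter_eq ▸ Set.inter_subset_right
  have hr : 0 < max r r' := hF.pos.trans_le (le_max_left _ _)
  have hr1 : max r r' < 1 := max_lt hF.lt_one hF'.lt_one
  have hR : 1 < min R R' := lt_min hF.one_lt hF'.one_lt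
  have smooth := hF.surface.smooth.mono subset
  have smooth' := hF'.surface.smooth.mono subset'
  have trace (p : Circle) : F' p = F p := (hF'.eq_curve p).trans (hF.eq_curve p).symm
  have hCoord_eq : Set.EqOn (hCoord F') (hCoord F) (annulus (max r r') (min R R')) :=
    eqOn_annulus_of_cauchyData hr hr1 hR (contDiffOn_hCoord smooth') (contDiffOn_hCoord smooth)
      (fun z hz => hF'.surface.harmonic_h z (subset' hz))
      (fun z hz => hF.surface.harmonic_h z (subset hz)) (fun p => congrArg Prod.fst (trace p))
      (fun p => hasDerivAt_fst (hF'.radial_deriv p)) fun p => hasDerivAt_fst (hF.radial_deriv p)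
  have wCoord_eq : Set.EqOn (wCoord F') (wCoord F) (annulus (max r r') (min R R')) :=
    eqOn_annulus_of_cauchyData hr hr1 hR (contDiffOn_wCoord smooth') (contDiffOn_wCoord smooth)
      (fun z hz => hF'.surface.harmonic_w z (subset' hz))
      (fun z hz => hF.surface.harmonic_w z (subset hz))
      (fun p => congrArg (fun x : LorentzSpace => (x.2 : ℂ)) (trace p))
      (fun p => hasDerivAt_ofReal_snd (hF'.radial_deriv p))
      fun p => hasDerivAt_ofReal_snd (hF.radial_deriv p)
  rw [inter_eq]
  exact fun z hz => Prod.ext (hCoord_eq hz) (ofReal_injective (wCoord_eq hz))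

/-! ### Null vectors and the Gauss map -/

section NullVectors

variable {u v : LorentzSpace}

theorem norm_fst_of_isNull (hu : IsNull u) : ‖u.1‖ = |u.2| := by
  rw [norm_eq_sqrt_sq_add_sq, ← Real.sqrt_sq_eq_abs]
  congr 1
  rw [IsNull, lorentzInner] at hu
  linear_combination hu

theorem snd_ne_zero_of_isNull (hu : IsNull u) (hu0 : u ≠ 0) : u.2 ≠ 0 := fun h =>
  hu0 (Prod.ext (norm_eq_zero.1 (by rw [norm_fst_of_isNull hu, h, abs_zero])) h)

theorem exists_circle_fst_eq_snd_mul (hu : IsNull u) : ∃ e : Circle, u.1 = u.2 * e := by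
  by_cases hu0 : u = 0
  · exact ⟨1, by simp [hu0]⟩
  have hu2 := snd_ne_zero_of_isNull hu hu0
  have unit : ‖u.1 / u.2‖ = 1 := by
    rw [norm_div, norm_fst_of_isNull hu, norm_real, Real.norm_eq_abs,
      div_self (abs_ne_zero.2 hu2)]
  exact ⟨⟨u.1 / u.2, mem_sphere_zero_iff_norm.2 unit⟩,
    (mul_div_cancel₀ _ (ofReal_ne_zero.2 hu2)).symm⟩

theorem fst_mul_snd_comm_of_isNull (hu : IsNull u) (hv : IsNull v) (huv : lorentzInner u v = 0) :
    u.1 * v.2 = v.1 * u.2 := by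
  simp only [IsNull, lorentzInner] at hu hv huv
  have sum_sq : (u.1.re * v.2 - v.1.re * u.2) ^ 2 + (u.1.im * v.2 - v.1.im * u.2) ^ 2 = 0 := by
    linear_combination v.2 ^ 2 * hu + u.2 ^ 2 * hv - 2 * u.2 * v.2 * huv
  have norm_eq_zero : ‖u.1 * v.2 - v.1 * u.2‖ = 0 := by
    rw [norm_eq_sqrt_sq_add_sq, Real.sqrt_eq_zero']
    simpa using sum_sq.le
  exact sub_eq_zero.1 (_root_.norm_eq_zero.1 norm_eq_zero)

theorem exists_common_circle_fst_eq_snd_mul (hu : IsNull u) (hv : IsNull v)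
    (huv : lorentzInner u v = 0) : ∃ e : Circle, u.1 = u.2 * e ∧ v.1 = v.2 * e := by
  by_cases hu0 : u = 0
  · obtain ⟨e, he⟩ := exists_circle_fst_eq_snd_mul hv
    exact ⟨e, by simp [hu0], he⟩
  · obtain ⟨e, he⟩ := exists_circle_fst_eq_snd_mul hu
    refine ⟨e, he, mul_right_cancel₀ (ofReal_ne_zero.2 (snd_ne_zero_of_isNull hu hu0)) ?_⟩
    rw [← fst_mul_snd_comm_of_isNull hu hv huv, he]
    ring

theorem circle_mul_conj (e : Circle) : (e : ℂ) * conj (e : ℂ) = 1 := by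
  rw [← Circle.coe_inv_eq_conj, ← Circle.coe_mul, mul_inv_cancel, Circle.coe_one]

theorem ofReal_mul_circle_div_conj {c : ℝ} (hc : c ≠ 0) (e : Circle) :
    (c * e : ℂ) / conj (c * e : ℂ) = e ^ 2 := by
  rw [map_mul, conj_ofReal, mul_div_mul_left _ _ (ofReal_ne_zero.2 hc), ← Circle.coe_inv_eq_conj,
    Circle.coe_inv, div_inv_eq_mul, sq]

theorem ofReal_add_I_mul_eq_zero {a b : ℝ} : (a + I * b : ℂ) = 0 ↔ a = 0 ∧ b = 0 := by
  simp [Complex.ext_iff]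

end NullVectors

section Quotient

theorem meromorphicOrderAt_nonneg_of_frequently_norm_le {f : ℂ → ℂ} {z : ℂ} {C : ℝ}
    (hf : MeromorphicAt f z) (hC : ∃ᶠ w in 𝓝[≠] z, ‖f w‖ ≤ C) : 0 ≤ meromorphicOrderAt f z := by
  by_contra! pole
  have norm_gt : ∀ᶠ w in 𝓝[≠] z, C < ‖f w‖ :=
    (tendsto_norm_cobounded_atTop.comp
      ((tendsto_cobounded_iff_meromorphicOrderAt_neg hf).2 pole)).eventually_gt_atTop C
  obtain ⟨w, hle, hgt⟩ := (hC.and_eventually norm_gt).exists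
  exact hgt.not_ge hle

theorem eventually_nhdsNE_ne_zero_of_circle {W : ℂ → ℂ} (hW : ∀ p : Circle, AnalyticAt ℂ W p)
    (hW0 : ∃ p : Circle, W p ≠ 0) (p : Circle) : ∀ᶠ z in 𝓝[≠] (p : ℂ), W z ≠ 0 := by
  have hsphere : IsPreconnected (sphere (0 : ℂ) 1) :=
    isPreconnected_sphere (by simp [rank_real_complex]) 0 1
  have hanalytic : AnalyticOnNhd ℂ W (sphere (0 : ℂ) 1) := fun z hz => hW ⟨z, hz⟩
  refine (hW p).eventually_eq_zero_or_eventually_ne_zero.resolve_left fun hzero => ?_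
  obtain ⟨q, hq⟩ := hW0
  exact hq (hanalytic.eqOn_zero_of_preconnected_of_eventuallyEq_zero hsphere p.2 hzero q.2)

theorem exists_analyticAt_circle_quotient {P W : ℂ → ℂ} {C : ℝ}
    (hP : ∀ p : Circle, AnalyticAt ℂ P p) (hW : ∀ p : Circle, AnalyticAt ℂ W p)
    (hnorm : ∀ p : Circle, ‖P p‖ ≤ C * ‖W p‖) (hW0 : ∃ p : Circle, W p ≠ 0) :
    ∃ g : ℂ → ℂ, ∀ p : Circle, AnalyticAt ℂ g p ∧ g p * W p = P p := by
  have hmero : MeromorphicOn (P / W) (sphere (0 : ℂ) 1) := fun z hz =>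
    (hP ⟨z, hz⟩).meromorphicAt.div (hW ⟨z, hz⟩).meromorphicAt
  refine ⟨toMeromorphicNFOn (P / W) (sphere 0 1), fun p => ?_⟩
  have hp : (p : ℂ) ∈ sphere (0 : ℂ) 1 := p.2
  have hne := eventually_nhdsNE_ne_zero_of_circle hW hW0 p
  have bounded : ∃ᶠ z in 𝓝[≠] (p : ℂ), ‖(P / W) z‖ ≤ C := by
    refine ((frequently_nhdsNE_of_forall_circle (P := fun z => ‖P z‖ ≤ C * ‖W z‖) hnorm
      p).and_eventually hne).mono ?_
    rintro z ⟨hle, hz⟩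
    rwa [Pi.div_apply, norm_div, div_le_iff₀ (norm_pos_iff.2 hz)]
  have hanalytic : AnalyticAt ℂ (toMeromorphicNFOn (P / W) (sphere 0 1)) p := by
    rw [← (meromorphicNFOn_toMeromorphicNFOn (P / W) _ hp).meromorphicOrderAt_nonneg_iff_analyticAt,
      meromorphicOrderAt_toMeromorphicNFOn hmero hp]
    exact meromorphicOrderAt_nonneg_of_frequently_norm_le (hmero p hp) bounded
  have mul_eq : (fun z => toMeromorphicNFOn (P / W) (sphere 0 1) z * W z) =ᶠ[𝓝[≠] (p : ℂ)] P := by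
    filter_upwards [hne, hmero.toMeromorphicNFOn_eq_self_on_nhdsNE hp] with z hz heq
    rw [heq, Pi.div_apply, div_mul_cancel₀ _ hz]
  exact ⟨hanalytic, ((ContinuousAt.eventuallyEq_nhds_iff_eventuallyEq_nhdsNE
    (hanalytic.mul (hW p)).continuousAt (hP p).continuousAt).1 mul_eq).eq_of_nhds⟩

end Quotient

section BjorlingData

variable {γ L : Circle → LorentzSpace}

theorem analyticAt_angularDeriv (hγ : IsAnalyticOnCircle γ) (θ : ℝ) :
    AnalyticAt ℝ (angularDeriv γ) θ :=
  (hγ θ).deriv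

theorem hasDerivAt_angularDeriv (hγ : IsAnalyticOnCircle γ) (θ : ℝ) :
    HasDerivAt (fun t => γ (Circle.exp t)) (angularDeriv γ θ) θ :=
  (hγ θ).differentiableAt.hasDerivAt

theorem periodic_angularDeriv (γ : Circle → LorentzSpace) :
    Function.Periodic (angularDeriv γ) (2 * Real.pi) := fun θ => by
  rw [angularDeriv, ← deriv_comp_add_const]
  simp only [Circle.periodic_exp _, angularDeriv]

theorem exists_circle_angle (hdata : IsSingularBjorlingData γ L) (θ : ℝ) :
    ∃ e : Circle, (angularDeriv γ θ).1 = (angularDeriv γ θ).2 * e ∧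
      (L (Circle.exp θ)).1 = (L (Circle.exp θ)).2 * e :=
  exists_common_circle_fst_eq_snd_mul (hdata.null_curve θ) (hdata.null_field _)
    (hdata.orthogonal θ)

theorem exists_snd_ne_zero (hdata : IsSingularBjorlingData γ L) :
    ∃ θ : ℝ, ¬((angularDeriv γ θ).2 = 0 ∧ (L (Circle.exp θ)).2 = 0) := by
  rcases hdata.nontrivial with ⟨θ, hθ⟩ | ⟨p, hp⟩
  · exact ⟨θ, fun h => snd_ne_zero_of_isNull (hdata.null_curve θ) hθ h.1⟩
  · obtain ⟨θ, rfl⟩ := Circle.exp_surjective p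
    exact ⟨θ, fun h => snd_ne_zero_of_isNull (hdata.null_field _) hp h.2⟩

theorem exists_complexified_coordinate (hγ : IsAnalyticOnCircle γ) (hL : IsAnalyticOnCircle L)
    (c : LorentzSpace →L[ℝ] ℂ) : ∃ φ : ℂ → ℂ, (∀ p : Circle, AnalyticAt ℂ φ p) ∧
      ∀ θ : ℝ, φ (Circle.exp θ) = c (angularDeriv γ θ) + I * c (L (Circle.exp θ)) := by
  have hL_per : Function.Periodic (fun θ => L (Circle.exp θ)) (2 * Real.pi) :=
    Circle.periodic_exp.comp L
  exact exists_analyticAt_circle_extension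
    (fun θ => ((c.analyticAt _).comp (analyticAt_angularDeriv hγ θ)).add
      (analyticAt_const.mul ((c.analyticAt _).comp (hL θ))))
    fun θ => by simp only [periodic_angularDeriv γ θ, hL_per θ]

/- Either of `γ'` and `L` may vanish identically, so `e` is obtained as the quotient of the two
coordinates of `γ' + i L`, which vanishes only where both of them do. -/
theorem exists_analyticAt_circle_angle (hdata : IsSingularBjorlingData γ L) :
    ∃ g : ℂ → ℂ, (∀ p : Circle, AnalyticAt ℂ g p) ∧ ∀ (θ : ℝ) (e : Circle),
      (angularDeriv γ θ).1 = (angularDeriv γ θ).2 * e →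
      (L (Circle.exp θ)).1 = (L (Circle.exp θ)).2 * e →
      ¬((angularDeriv γ θ).2 = 0 ∧ (L (Circle.exp θ)).2 = 0) → g (Circle.exp θ) = e := by
  obtain ⟨P, hP, hPθ⟩ := exists_complexified_coordinate hdata.analytic_curve
    hdata.analytic_field (.fst ℝ ℂ ℝ)
  obtain ⟨W, hW, hWθ⟩ := exists_complexified_coordinate hdata.analytic_curve
    hdata.analytic_field (ofRealCLM ∘L .snd ℝ ℂ ℝ)
  replace hPθ (θ : ℝ) : P (Circle.exp θ) =
    (angularDeriv γ θ).1 + I * (L (Circle.exp θ)).1 := hPθ θ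
  replace hWθ (θ : ℝ) : W (Circle.exp θ) =
    (angularDeriv γ θ).2 + I * (L (Circle.exp θ)).2 := hWθ θ
  have eq_mul {θ : ℝ} {e : Circle} (hγ : (angularDeriv γ θ).1 = (angularDeriv γ θ).2 * e)
      (hL : (L (Circle.exp θ)).1 = (L (Circle.exp θ)).2 * e) :
      P (Circle.exp θ) = e * W (Circle.exp θ) := by
    rw [hPθ, hWθ, hγ, hL]
    ring
  have norm_le (p : Circle) : ‖P p‖ ≤ 1 * ‖W p‖ := by
    obtain ⟨θ, rfl⟩ := Circle.exp_surjective p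
    obtain ⟨e, hγ, hL⟩ := exists_circle_angle hdata θ
    rw [eq_mul hγ hL, norm_mul, Circle.norm_coe]
  have ne_zero {θ : ℝ} (hθ : ¬((angularDeriv γ θ).2 = 0 ∧ (L (Circle.exp θ)).2 = 0)) :
      W (Circle.exp θ) ≠ 0 := by
    rwa [hWθ, Ne, ofReal_add_I_mul_eq_zero]
  obtain ⟨θ₀, hθ₀⟩ := exists_snd_ne_zero hdata
  obtain ⟨g, hg⟩ := exists_analyticAt_circle_quotient hP hW norm_le ⟨_, ne_zero hθ₀⟩
  refine ⟨g, fun p => (hg p).1, fun θ e hγ hL hθ => mul_right_cancel₀ (ne_zero hθ) ?_⟩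
  rw [(hg _).2, eq_mul hγ hL]

theorem exists_isGaussExtension (hdata : IsSingularBjorlingData γ L) :
    ∃ (r R : ℝ) (G : ℂ → ℂ), IsGaussExtension γ L r R G := by
  obtain ⟨g, hg, hge⟩ := exists_analyticAt_circle_angle hdata
  obtain ⟨r, R, hr, hr1, hR, hholo⟩ := exists_annulus_of_forall_circle
    fun p => (hg p).eventually_analyticAt
  refine ⟨r, R, g, hr, hr1, hR,
    fun z hz => (hholo z hz).differentiableAt.differentiableWithinAt,
    fun θ hθ => ?_, fun θ hθ => ?_⟩
  all_goals obtain ⟨e, hγ, hL⟩ := exists_circle_angle hdata θ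
  · have snd_ne_zero : (L (Circle.exp θ)).2 ≠ 0 := fun h => hθ (by simp [hL, h])
    rw [hge θ e hγ hL fun h => snd_ne_zero h.2, hL, ofReal_mul_circle_div_conj snd_ne_zero]
  · have snd_ne_zero : (angularDeriv γ θ).2 ≠ 0 := fun h => hθ (by simp [hγ, h])
    rw [hge θ e hγ hL fun h => snd_ne_zero h.1, hγ, ofReal_mul_circle_div_conj snd_ne_zero]

theorem sq_eq_of_isGaussExtension {r₀ R₀ : ℝ} {G : ℂ → ℂ} (hG : IsGaussExtension γ L r₀ R₀ G)
    {θ : ℝ} {e : Circle} (hγ : (angularDeriv γ θ).1 = (angularDeriv γ θ).2 * e)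
    (hL : (L (Circle.exp θ)).1 = (L (Circle.exp θ)).2 * e)
    (hθ : ¬((angularDeriv γ θ).2 = 0 ∧ (L (Circle.exp θ)).2 = 0)) :
    G (Circle.exp θ) ^ 2 = e ^ 2 := by
  rcases not_and_or.1 hθ with h | h
  · rw [hG.sq_curve θ (by simpa [hγ] using h), hγ, ofReal_mul_circle_div_conj h]
  · rw [hG.sq_field θ (by simpa [hL] using h), hL, ofReal_mul_circle_div_conj h]

end BjorlingData

/-! ### Existence -/

/-- `F` solves, near the unit circle, the Cauchy problem for the Laplace equation with `F = γ` and
`∂F/∂ρ = L` on the unit circle. -/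
structure IsCauchySolution (γ L : Circle → LorentzSpace) (F : ℂ → LorentzSpace) : Prop where
  harmonic_h : ∀ p : Circle, IsComplexHarmonicAt (hCoord F) p
  harmonic_w : ∀ p : Circle, IsComplexHarmonicAt (wCoord F) p
  eq_curve : ∀ p : Circle, F p = γ p
  radial_deriv : ∀ p : Circle, HasDerivAt (fun ρ : ℝ => F (ρ * p)) (L p) 1

theorem exists_isComplexHarmonicAt_coordinate {γ L : Circle → LorentzSpace}
    (hγ : IsAnalyticOnCircle γ) (hL : IsAnalyticOnCircle L) (c : LorentzSpace →L[ℝ] ℂ) :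
    ∃ h : ℂ → ℂ, (∀ p : Circle, IsComplexHarmonicAt h p) ∧ (∀ p : Circle, h p = c (γ p)) ∧
      ∀ p : Circle, HasDerivAt (fun ρ : ℝ => h (ρ * p)) (c (L p)) 1 := by
  have hper (f : Circle → LorentzSpace) :
      Function.Periodic (fun θ => c (f (Circle.exp θ))) (2 * Real.pi) :=
    Circle.periodic_exp.comp (c ∘ f)
  obtain ⟨h, harmonic, trace, radial⟩ := exists_isComplexHarmonicAt_cauchyData
    (fun θ => (c.analyticAt _).comp (hγ θ)) (hper γ) (fun θ => (c.analyticAt _).comp (hL θ))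
    (hper L)
  exact ⟨h, harmonic, Circle.exp_surjective.forall.2 trace, Circle.exp_surjective.forall.2 radial⟩

theorem exists_isCauchySolution {γ L : Circle → LorentzSpace} (hγ : IsAnalyticOnCircle γ)
    (hL : IsAnalyticOnCircle L) : ∃ F, IsCauchySolution γ L F := by
  obtain ⟨h, harmonic_h, trace_h, radial_h⟩ :=
    exists_isComplexHarmonicAt_coordinate hγ hL (.fst ℝ ℂ ℝ)
  obtain ⟨w, harmonic_w, trace_w, radial_w⟩ :=
    exists_isComplexHarmonicAt_coordinate hγ hL (ofRealCLM ∘L .snd ℝ ℂ ℝ)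
  refine ⟨fun z => (h z, (w z).re), harmonic_h, fun p => (harmonic_w p).ofReal_re,
    fun p => Prod.ext (trace_h p) ?_, fun p => ?_⟩
  · exact congrArg re (trace_w p)
  · exact (radial_h p).prodMk (reCLM.hasFDerivAt.comp_hasDerivAt (1 : ℝ) (radial_w p))

theorem contDiffAt_of_isComplexHarmonicAt {F : ℂ → LorentzSpace} {z : ℂ}
    (hh : IsComplexHarmonicAt (hCoord F) z) (hw : IsComplexHarmonicAt (wCoord F) z) :
    ContDiffAt ℝ ∞ F z :=
  hh.contDiffAt.prodMk (reCLM.contDiff.contDiffAt.comp z hw.contDiffAt)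

namespace IsCauchySolution

variable {γ L : Circle → LorentzSpace} {F : ℂ → LorentzSpace} (hF : IsCauchySolution γ L F)
  {θ : ℝ} {e : Circle}
include hF

theorem hasDerivAt_angular (hγ : IsAnalyticOnCircle γ) (θ : ℝ) :
    HasDerivAt (fun t => F (Circle.exp t)) (angularDeriv γ θ) θ := by
  simpa only [hF.eq_curve] using hasDerivAt_angularDeriv hγ θ

theorem wirtinger_wCoord_mul_circleExp (hγ : IsAnalyticOnCircle γ) (θ : ℝ) :
    wirtinger (wCoord F) (Circle.exp θ) * Circle.exp θ =
      ((L (Circle.exp θ)).2 - I * (angularDeriv γ θ).2) / 2 :=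
  wirtinger_mul_circleExp (hF.harmonic_w _).differentiableAt
    (hasDerivAt_ofReal_snd (hF.hasDerivAt_angular hγ θ))
    (hasDerivAt_ofReal_snd (hF.radial_deriv _))

theorem wirtinger_hCoord_eq (hγ : IsAnalyticOnCircle γ)
    (hγe : (angularDeriv γ θ).1 = (angularDeriv γ θ).2 * e)
    (hLe : (L (Circle.exp θ)).1 = (L (Circle.exp θ)).2 * e) :
    wirtinger (hCoord F) (Circle.exp θ) = e * wirtinger (wCoord F) (Circle.exp θ) := by
  refine mul_right_cancel₀ (Circle.coe_ne_zero (Circle.exp θ)) ?_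
  rw [mul_assoc, hF.wirtinger_wCoord_mul_circleExp hγ, wirtinger_mul_circleExp
    (hF.harmonic_h _).differentiableAt (hasDerivAt_fst (hF.hasDerivAt_angular hγ θ))
    (hasDerivAt_fst (hF.radial_deriv _)), hγe, hLe]
  ring

theorem conj_wirtingerBar_hCoord_eq (hγ : IsAnalyticOnCircle γ)
    (hγe : (angularDeriv γ θ).1 = (angularDeriv γ θ).2 * e)
    (hLe : (L (Circle.exp θ)).1 = (L (Circle.exp θ)).2 * e) :
    conj (wirtingerBar (hCoord F) (Circle.exp θ)) =
      conj (e : ℂ) * wirtinger (wCoord F) (Circle.exp θ) := by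
  refine mul_right_cancel₀ (Circle.coe_ne_zero (Circle.exp θ)) ?_
  rw [mul_assoc, hF.wirtinger_wCoord_mul_circleExp hγ, conj_wirtingerBar_mul_circleExp
    (hF.harmonic_h _).differentiableAt (hasDerivAt_fst (hF.hasDerivAt_angular hγ θ))
    (hasDerivAt_fst (hF.radial_deriv _)), hγe, hLe]
  simp only [map_mul, conj_ofReal]
  ring

theorem wirtinger_wCoord_eq_zero_iff (hγ : IsAnalyticOnCircle γ) :
    wirtinger (wCoord F) (Circle.exp θ) = 0 ↔
      (angularDeriv γ θ).2 = 0 ∧ (L (Circle.exp θ)).2 = 0 := by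
  rw [← mul_eq_zero_iff_right (Circle.coe_ne_zero (Circle.exp θ)),
    hF.wirtinger_wCoord_mul_circleExp hγ, div_eq_zero_iff, or_iff_left two_ne_zero]
  simp [Complex.ext_iff, and_comm]

variable (hdata : IsSingularBjorlingData γ L)
include hdata

theorem norm_wirtinger_eq (p : Circle) :
    ‖wirtinger (hCoord F) p‖ = ‖wirtingerBar (hCoord F) p‖ := by
  obtain ⟨θ, rfl⟩ := Circle.exp_surjective p
  obtain ⟨e, hγe, hLe⟩ := exists_circle_angle hdata θ
  rw [← norm_conj (wirtingerBar _ _), hF.wirtinger_hCoord_eq hdata.analytic_curve hγe hLe,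
    hF.conj_wirtingerBar_hCoord_eq hdata.analytic_curve hγe hLe, norm_mul, norm_mul, norm_conj]

theorem eventually_conformal (p : Circle) : ∀ᶠ z in 𝓝 (p : ℂ),
    wirtinger (hCoord F) z * conj (wirtingerBar (hCoord F) z) = wirtinger (wCoord F) z ^ 2 := by
  refine eventuallyEq_of_eq_on_circle ((hF.harmonic_h p).analyticAt_wirtinger.mul
    (hF.harmonic_h p).analyticAt_conj_wirtingerBar)
    ((hF.harmonic_w p).analyticAt_wirtinger.pow 2) fun q => ?_
  obtain ⟨θ, rfl⟩ := Circle.exp_surjective q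
  obtain ⟨e, hγe, hLe⟩ := exists_circle_angle hdata θ
  simp only [hF.wirtinger_hCoord_eq hdata.analytic_curve hγe hLe,
    hF.conj_wirtingerBar_hCoord_eq hdata.analytic_curve hγe hLe]
  linear_combination wirtinger (wCoord F) (Circle.exp θ) ^ 2 * circle_mul_conj e

theorem eventually_gauss_sq_mul {r₀ R₀ : ℝ} {G : ℂ → ℂ} (hG : IsGaussExtension γ L r₀ R₀ G)
    (p : Circle) : ∀ᶠ z in 𝓝 (p : ℂ),
      G z ^ 2 * conj (wirtingerBar (hCoord F) z) = wirtinger (hCoord F) z := by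
  have hGp : AnalyticAt ℂ G p := hG.holomorphic.analyticAt
    ((isOpen_annulus r₀ R₀).mem_nhds (circle_mem_annulus hG.lt_one hG.one_lt p))
  refine eventuallyEq_of_eq_on_circle ((hGp.pow 2).mul
    (hF.harmonic_h p).analyticAt_conj_wirtingerBar)
    (hF.harmonic_h p).analyticAt_wirtinger fun q => ?_
  obtain ⟨θ, rfl⟩ := Circle.exp_surjective q
  obtain ⟨e, hγe, hLe⟩ := exists_circle_angle hdata θ
  simp only [hF.wirtinger_hCoord_eq hdata.analytic_curve hγe hLe,
    hF.conj_wirtingerBar_hCoord_eq hdata.analytic_curve hγe hLe]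
  by_cases hθ : (angularDeriv γ θ).2 = 0 ∧ (L (Circle.exp θ)).2 = 0
  · rw [(hF.wirtinger_wCoord_eq_zero_iff hdata.analytic_curve).2 hθ, mul_zero, mul_zero, mul_zero]
  · rw [sq_eq_of_isGaussExtension hG hγe hLe hθ]
    linear_combination e * wirtinger (wCoord F) (Circle.exp θ) * circle_mul_conj e

theorem exists_frequently_norm_wirtinger_ne {r₀ R₀ : ℝ} {G : ℂ → ℂ}
    (hG : IsGaussExtension γ L r₀ R₀ G) (hG1 : ∃ z ∈ annulus r₀ R₀, ‖G z‖ ≠ 1) :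
    ∃ p : Circle, ∃ᶠ z in 𝓝 (p : ℂ), ‖wirtinger (hCoord F) z‖ ≠ ‖wirtingerBar (hCoord F) z‖ := by
  obtain ⟨θ, hθ⟩ := exists_snd_ne_zero hdata
  refine ⟨Circle.exp θ, fun norm_eq => ?_⟩
  have wirtingerBar_ne_zero : conj (wirtingerBar (hCoord F) (Circle.exp θ)) ≠ 0 := by
    obtain ⟨e, hγe, hLe⟩ := exists_circle_angle hdata θ
    rw [hF.conj_wirtingerBar_hCoord_eq hdata.analytic_curve hγe hLe]
    exact mul_ne_zero ((map_ne_zero _).2 (Circle.coe_ne_zero e))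
      ((hF.wirtinger_wCoord_eq_zero_iff hdata.analytic_curve).not.2 hθ)
  have norm_gauss : ∀ᶠ z in 𝓝 (Circle.exp θ : ℂ), ‖G z‖ = 1 := by
    filter_upwards [norm_eq, hF.eventually_gauss_sq_mul hdata hG (Circle.exp θ),
      (hF.harmonic_h _).analyticAt_conj_wirtingerBar.continuousAt.eventually_ne
        wirtingerBar_ne_zero] with z hnorm hsq hne
    have hnorm_sq := congrArg norm hsq
    rw [norm_mul, norm_pow, not_not.1 hnorm, ← norm_conj (wirtingerBar _ _),
      mul_eq_right₀ (norm_ne_zero_iff.2 hne)] at hnorm_sq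
    exact (pow_eq_one_iff_of_nonneg (norm_nonneg _) two_ne_zero).1 hnorm_sq
  obtain ⟨z, hz, hz1⟩ := hG1
  exact hz1 (norm_eq_of_eventually_norm_eq (isOpen_annulus r₀ R₀)
    (isPreconnected_annulus hG.pos (zero_lt_one.trans hG.one_lt)) hG.holomorphic
    (circle_mem_annulus hG.lt_one hG.one_lt _) norm_gauss z hz)

end IsCauchySolution

theorem exists_solution {γ L : Circle → LorentzSpace} (hdata : IsSingularBjorlingData γ L)
    {r₀ R₀ : ℝ} {G : ℂ → ℂ} (hG : IsGaussExtension γ L r₀ R₀ G)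
    (hG1 : ∃ z ∈ annulus r₀ R₀, ‖G z‖ ≠ 1) :
    ∃ (r R : ℝ) (F : ℂ → LorentzSpace), SolvesSingularBjorling γ L r R F ∧
      sphere (0 : ℂ) 1 ⊆ singularSet F (annulus r R) := by
  obtain ⟨F, hF⟩ := exists_isCauchySolution hdata.analytic_curve hdata.analytic_field
  obtain ⟨r, R, hr, hr1, hR, on_annulus⟩ := exists_annulus_of_forall_circle fun p =>
    ((hF.harmonic_h p).eventually.and (hF.harmonic_w p).eventually).and
      (hF.eventually_conformal hdata p)
  have circle_mem := circle_mem_annulus hr1 hR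
  have isOpen := isOpen_annulus r R
  obtain ⟨p, frequently_ne⟩ := hF.exists_frequently_norm_wirtinger_ne hdata hG hG1
  obtain ⟨z, hne, hz⟩ :=
    (frequently_ne.and_eventually (isOpen.eventually_mem (circle_mem p))).exists
  refine ⟨r, R, F, ⟨hr, hr1, hR, ?_, hF.eq_curve, hF.radial_deriv⟩, fun p hp =>
    ⟨circle_mem ⟨p, hp⟩, hF.norm_wirtinger_eq hdata ⟨p, hp⟩⟩⟩
  exact {
    isOpen := isOpen
    isConnected := ⟨⟨_, circle_mem 1⟩, isPreconnected_annulus hr (zero_lt_one.trans hR)⟩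
    smooth := fun z hz => (contDiffAt_of_isComplexHarmonicAt (on_annulus z hz).1.1
      (on_annulus z hz).1.2).contDiffWithinAt
    harmonic_h := fun z hz => (on_annulus z hz).1.1.wirtingerBar_wirtinger
    harmonic_w := fun z hz => (on_annulus z hz).1.2.wirtingerBar_wirtinger
    conformal := fun z hz => sub_eq_zero.2 (on_annulus z hz).2
    nondegenerate := ⟨z, hz, hne⟩ }

end SingularBjorling

theorem mainTheorem1 (γ L : Circle → LorentzSpace) (hdata : IsSingularBjorlingData γ L) :
    (∃ (r R : ℝ) (G : ℂ → ℂ), IsGaussExtension γ L r R G) ∧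
    ∀ (r₀ R₀ : ℝ) (G : ℂ → ℂ), IsGaussExtension γ L r₀ R₀ G →
      (∃ z ∈ annulus r₀ R₀, ‖G z‖ ≠ 1) →
      ∃ (r R : ℝ) (F : ℂ → LorentzSpace),
        SolvesSingularBjorling γ L r R F ∧
        Metric.sphere (0 : ℂ) 1 ⊆ singularSet F (annulus r R) ∧
        ∀ (r' R' : ℝ) (F' : ℂ → LorentzSpace), SolvesSingularBjorling γ L r' R' F' →
          Set.EqOn F' F (annulus r R ∩ annulus r' R') := by
  refine ⟨SingularBjorling.exists_isGaussExtension hdata, fun r₀ R₀ G hG hG1 => ?_⟩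
  obtain ⟨r, R, F, hF, hsing⟩ := SingularBjorling.exists_solution hdata hG hG1
  exact ⟨r, R, F, hF, hsing, fun r' R' F' hF' =>
    SingularBjorling.eqOn_of_solvesSingularBjorling hF hF'⟩
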